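/- Let $(\Omega,\mathcal F,\mathbb P)$ be a probability space and let $X=(X_t)_{t\in\mathbb R_+}$ be a real-valued stochastic process on it. Suppose that $X$ is cadlag (almost surely, its path is right-continuous and has finite left limits) and left-continuous in probability, that is, for every $t>0$, $X_s\to X_t$ in probability as $s\uparrow t$. For a real random variable $Y$, let $\mathrm{supp}(Y)$ be the smallest closed set $F\subseteq\mathbb R$ with $\mathbb P(Y\in F)=1$, and define the marginal support of $X$ by $$\mathrm{MSupp}(X)=\{(t,x)\in\mathbb R_+\times\mathbb R : x\in\mathrm{supp}(X_t)\}.$$ Write $X_{t-}=\lim_{s\uparrow t}X_s$ for $t>0$ and $X_{0-}=X_0$. Then, with probability $1$, $$\{(t,X_{t-}):t\in\mathbb R_+\}\subseteq\mathrm{MSupp}(X).$$ -/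

import Mathlib

open MeasureTheory Filter Topology Set
open scoped NNReal

/-- A path `x : ℝ₊ → ℝ` is cadlag: right-continuous at every time, with a finite left limit at
every time (at `t = 0` the left-limit condition is vacuous). -/
def IsCadlagPath (x : ℝ≥0 → ℝ) : Prop :=
  ∀ t : ℝ≥0, ContinuousWithinAt x (Ici t) t ∧ ∃ l : ℝ, Tendsto x (𝓝[<] t) (𝓝 l)

/-- `X` is left-continuous in probability: `X s → X t` in probability as `s ↑ t`, for every `t`. -/
def LeftContinuousInProbability {Ω : Type*} [MeasurableSpace Ω] (P : Measure Ω)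
    (X : ℝ≥0 → Ω → ℝ) : Prop :=
  ∀ t : ℝ≥0, TendstoInMeasure P X (𝓝[<] t) (X t)

/-- The marginal support of `X`: the pairs `(t, x)` such that `x` is in the support of the law
of `X t`. -/
def marginalSupport {Ω : Type*} [MeasurableSpace Ω] (P : Measure Ω)
    (X : ℝ≥0 → Ω → ℝ) : Set (ℝ≥0 × ℝ) :=
  {p | p.2 ∈ (P.map (X p.1)).support}

/-- The support of the law of a real random variable is the smallest closed set that contains
the variable with probability one. -/
theorem isLeast_support_map {Ω : Type*} [MeasurableSpace Ω] (P : Measure Ω)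
    [IsProbabilityMeasure P] (Y : Ω → ℝ) (hY : Measurable Y) :
    IsLeast {F : Set ℝ | IsClosed F ∧ P (Y ⁻¹' F) = 1} (P.map Y).support := by
  have : IsProbabilityMeasure (P.map Y) := Measure.isProbabilityMeasure_map hY.aemeasurable
  have key : ∀ F : Set ℝ, IsClosed F → (P (Y ⁻¹' F) = 1 ↔ F ∈ ae (P.map Y)) := by
    intro F hF
    rw [← Measure.map_apply hY hF.measurableSet, mem_ae_iff,
      prob_compl_eq_zero_iff hF.measurableSet]
  constructor
  · exact ⟨Measure.isClosed_support,
      (key _ Measure.isClosed_support).2 Measure.support_mem_ae⟩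
  · rintro F ⟨hF, h⟩
    exact Measure.support_subset_of_isClosed hF ((key F hF).1 h)

/-! If `X_{t-}` leaves the support, some basic open `U` contains it with `P(X_t ∈ U) = 0`. For each
of countably many `U`, a countable set `D` of such null times suffices: on `D`, a.s. `X_{t-} = X_t ∉
U`; at left limits of `D`, avoidance of the open `U` passes to `X_{t-}`. -/

/-- Every set of times has a countable subset `D` such that each point of the set lies in `D` or is
a limit of points of `D` from the left. -/
theorem exists_countable_subset_frequently_nhdsLT {α : Type*} [LinearOrder α] [TopologicalSpace α]
    [OrderTopology α] [SecondCountableTopology α] (S : Set α) :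
    ∃ D ⊆ S, D.Countable ∧ ∀ t ∈ S, t ∈ D ∨ ∃ᶠ s in 𝓝[<] t, s ∈ D := by
  obtain ⟨D, hDS, hDc, hSD⟩ :=
    (TopologicalSpace.IsSeparable.of_separableSpace S).exists_countable_dense_subset
  -- Density alone may approach `t` only from the right; the left-isolated points of `S` are
  -- countable, so add them all.
  refine ⟨D ∪ {t ∈ S | 𝓝[S ∩ Iio t] t = ⊥}, union_subset hDS (sep_subset _ _),
    hDc.union countable_setOfPred_isolated_left_within, fun t ht => ?_⟩
  by_cases hiso : 𝓝[S ∩ Iio t] t = ⊥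
  · exact Or.inl (Or.inr ⟨ht, hiso⟩)
  refine Or.inr ?_
  have hne : (𝓝[S ∩ Iio t] t).NeBot := ⟨hiso⟩
  rw [frequently_nhdsWithin_iff, frequently_nhds_iff]
  intro U htU hU
  obtain ⟨s, ⟨hsS, hst⟩, hsU⟩ := hne.nonempty_of_mem
    (inter_mem (self_mem_nhdsWithin (a := t)) (mem_nhdsWithin_of_mem_nhds (hU.mem_nhds htU)))
  obtain ⟨r, ⟨hrU, hrt⟩, hrD⟩ :=
    mem_closure_iff.1 (hSD hsS) (U ∩ Iio t) (hU.inter isOpen_Iio) ⟨hsU, hst⟩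
  exact ⟨r, hrU, Or.inl hrD, hrt⟩

/-- If almost every path has left limits, then at each fixed time the left limit coincides almost
surely with the left limit in probability. -/
theorem ae_leftLim_eq_of_leftContinuousInProbability {Ω : Type*} [MeasurableSpace Ω]
    {P : Measure Ω} {X : ℝ≥0 → Ω → ℝ} (hcadlag : ∀ᵐ ω ∂P, IsCadlagPath (fun t => X t ω))
    (hleft : LeftContinuousInProbability P X) (t : ℝ≥0) :
    ∀ᵐ ω ∂P, Function.leftLim (fun s => X s ω) t = X t ω := by
  rcases eq_or_neBot (𝓝[<] t) with hbot | hne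
  -- Here `t = 0`, where `leftLim` defaults to the value.
  · exact ae_of_all _ fun ω => leftLim_eq_of_eq_bot _ hbot
  obtain ⟨u, hu, hlim⟩ := (hleft t).exists_seq_tendsto_ae'
  filter_upwards [hcadlag, hlim] with ω hω hω'
  exact tendsto_nhds_unique ((tendsto_leftLim_of_tendsto (hω t).2).comp hu) hω'

/-- For a fixed open set `U`, almost surely the left limits avoid `U` simultaneously at all times
`t` at which `X t` avoids `U` almost surely. -/
theorem ae_forall_leftLim_notMem {Ω : Type*} [MeasurableSpace Ω] {P : Measure Ω}
    {X : ℝ≥0 → Ω → ℝ} (hcadlag : ∀ᵐ ω ∂P, IsCadlagPath (fun t => X t ω))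
    (hleft : LeftContinuousInProbability P X) {U : Set ℝ} (hU : IsOpen U) :
    ∀ᵐ ω ∂P, ∀ t, P (X t ⁻¹' U) = 0 → Function.leftLim (fun s => X s ω) t ∉ U := by
  obtain ⟨D, hDS, hDc, hD⟩ := exists_countable_subset_frequently_nhdsLT {t | P (X t ⁻¹' U) = 0}
  have havoid : ∀ᵐ ω ∂P, ∀ t ∈ D, X t ω ∉ U :=
    (ae_ball_iff hDc).2 fun t ht => measure_eq_zero_iff_ae_notMem.1 (hDS ht)
  have hlim : ∀ᵐ ω ∂P, ∀ t ∈ D, Function.leftLim (fun s => X s ω) t = X t ω :=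
    (ae_ball_iff hDc).2 fun t _ => ae_leftLim_eq_of_leftContinuousInProbability hcadlag hleft t
  filter_upwards [hcadlag, havoid, hlim] with ω hω hωU hωlim t ht htU
  rcases hD t ht with htD | hfreq
  · exact hωU t htD (hωlim t htD ▸ htU)
  · obtain ⟨s, hsD, hsU⟩ := (hfreq.and_eventually
      ((tendsto_leftLim_of_tendsto (hω t).2).eventually (hU.mem_nhds htU))).exists
    exact hωU s hsD hsU

/-- `Function.leftLim (fun s => X s ω) t` is the left limit `X_{t-}(ω)`, which equals `X_0(ω)`
at `t = 0`. -/
theorem mainTheorem7 {Ω : Type*} [MeasurableSpace Ω] (P : Measure Ω) [IsProbabilityMeasure P]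
    (X : ℝ≥0 → Ω → ℝ) (hX : ∀ t, Measurable (X t))
    (hcadlag : ∀ᵐ ω ∂P, IsCadlagPath (fun t => X t ω))
    (hleft : LeftContinuousInProbability P X) :
    ∀ᵐ ω ∂P, Set.range (fun t : ℝ≥0 => (t, Function.leftLim (fun s => X s ω) t)) ⊆
      marginalSupport P X := by
  have hbasis := TopologicalSpace.isBasis_countableBasis ℝ
  have hae : ∀ᵐ ω ∂P, ∀ U ∈ TopologicalSpace.countableBasis ℝ, ∀ t, P (X t ⁻¹' U) = 0 →
      Function.leftLim (fun s => X s ω) t ∉ U :=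
    (ae_ball_iff (TopologicalSpace.countable_countableBasis ℝ)).2 fun U hU =>
      ae_forall_leftLim_notMem hcadlag hleft (hbasis.isOpen hU)
  filter_upwards [hae] with ω hω
  rintro _ ⟨t, rfl⟩
  by_contra hmem
  obtain ⟨U, ⟨hU, htU⟩, hU0⟩ := hbasis.nhds_hasBasis.notMem_measureSupport.1 hmem
  rw [Measure.map_apply (hX t) (hbasis.isOpen hU).measurableSet] at hU0
  exact hω U hU t hU0 htU
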